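/- Let $V$ be a finite-dimensional real inner product space of dimension $d$ and $E \subseteq V$ a closed set that contains $0$ and has a connected component containing an affine basis of $V$ (that is, $d+1$ affinely independent points). Let $E_\Delta = E \sqcup \{\Delta\}$, where the cemetery $\Delta$ is adjoined as an isolated point, with $\sigma$-algebra $\mathcal E_\Delta = \sigma(\mathcal B(E), \{\Delta\})$. Functions on $E$ are extended to $E_\Delta$ by the value $0$ at $\Delta$. A transition function is a family $\{P_{s,t}\}_{0 \le s \le t}$ of transition probabilities on $(E_\Delta, \mathcal E_\Delta)$ with $P_{s,t}(\Delta, \{\Delta\}) = 1$, $P_{s,s}(x, \cdot) = \delta_x$, and $P_{s,u} P_{u,t} = P_{s,t}$ for $s < u < t$. It is stochastically continuous if for every $x \in E_\Delta$, $P_{s,S}(x, \cdot) \to P_{t,T}(x, \cdot)$ weakly on $E_\Delta$ whenever $(s,S) \to (t,T)$ with $0 \le s \le S$ and $0 \le t \le T$. Let $\langle \cdot, \cdot \rangle$ also denote the bilinear extension $\langle a + \mathrm i b, x \rangle = \langle a, x \rangle + \mathrm i \langle b, x \rangle$ of the inner product. For $u \in V + \mathrm i V$ let $f_u(x) = e^{\langle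 u, x \rangle}$ on $E$ and $f_u(\Delta) = 0$. For $k \in \mathbb N$ put $$\mathcal U_k = \{u \in V + \mathrm i V : \sup_{x \in E} |e^{\langle u, x \rangle}| \le k\}, \qquad \mathcal U = \bigcup_k \mathcal U_k .$$ Let $\{P_{s,t}\}$ be an affine transition function, with functions $\Phi_{s,t} : \mathcal U \to \mathbb C$ and $\psi_{s,t} : \mathcal U \to V + \mathrm i V$ satisfying $$P_{s,t} f_u(x) = \Phi_{s,t}(u)\, e^{\langle \psi_{s,t}(u), x \rangle} \qquad \text{for all } 0 \le s \le t,\ u \in \mathcal U,\ x \in E,$$ and put $$\mathcal Q_k = \{(t,T,u) : 0 \le t \le T,\ u \in \mathcal U_k,\ \Phi_{v,T}(u) \ne 0 \text{ for all } v \in [t,T]\}.$$ Then the following are equivalent. 1. $\{P_{s,t}\}$ is stochastically continuous. 2. For every $k \in \mathbb N$ the map $(t,T,u) \mapsto \psi_{t,T}(u)$ is continuous on $\mathcal Q_k$, and $\psi_{0,0}(0) = 0$; and for every $x \in E$ and $k \in \mathbb N$ the maps $(t,T,u) \mapsto \Phi_{t,T}(u)$ and $(t,T,u) \mapsto P_{t,T}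 f_u(x)$ are continuous on $\{(t,T,u) : 0 \le t \le T,\ u \in \mathcal U_k\}$. -/

import Mathlib

open MeasureTheory ProbabilityTheory Set Topology
open scoped NNReal

namespace AffineProcess

/-- The state space `E` with a cemetery point `Δ` adjoined as an isolated point. Its topology is the
disjoint-union topology, so the continuous functions on it are the continuous functions on `E` with
an arbitrary value at `Δ`; its σ-algebra is the one generated by the Borel sets of `E`
and `{Δ}`. -/
abbrev WithCemetery {V : Type*} (E : Set V) : Type _ := ↥E ⊕ Unit

/-- The cemetery point. -/
abbrev cemetery {V : Type*} (E : Set V) : WithCemetery E := Sum.inr ()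

/-- The σ-algebra `σ(𝓑(E), {Δ})` contains the open sets of `E ∪ {Δ}`. -/
instance instOpensMeasurableSpaceWithCemetery {V : Type*} [TopologicalSpace V] [MeasurableSpace V]
    [BorelSpace V] (E : Set V) : OpensMeasurableSpace (WithCemetery E) where
  borel_le := by
    refine MeasurableSpace.generateFrom_le fun s hs => ?_
    rw [measurableSet_sum_iff]
    have h := isOpen_sum_iff.1 hs
    exact ⟨h.1.measurableSet, MeasurableSet.of_discrete⟩

/-- A (time-inhomogeneous) transition function `{P_{s,t}}_{0 ≤ s ≤ t}` on `E ∪ {Δ}`.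
The values `P s t` for `t < s` are irrelevant: nothing is required of them and nothing uses them. -/
structure TransitionFunction {V : Type*} [MeasurableSpace V] (E : Set V) where
  /-- The kernels. -/
  P : ℝ≥0 → ℝ≥0 → Kernel (WithCemetery E) (WithCemetery E)
  /-- Each `P_{s,t}` is a transition probability. -/
  isProb : ∀ s t, s ≤ t → ∀ x, IsProbabilityMeasure (P s t x)
  /-- The cemetery is absorbing. -/
  absorbing : ∀ s t, s ≤ t → P s t (cemetery E) = Measure.dirac (cemetery E)
  /-- `P_{s,s}(x, ·) = δ_x`. -/
  diag : ∀ s x, P s s x = Measure.dirac x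
  /-- Chapman–Kolmogorov: `P_{s,u} P_{u,t} = P_{s,t}`, where
  `P_{s,u} P_{u,t} (x, A) = ∫ P_{u,t}(y, A) P_{s,u}(x, dy)`. -/
  chapman_kolmogorov : ∀ s u t, s < u → u < t → (P u t) ∘ₖ (P s u) = P s t

/-- The set of pairs of times `0 ≤ s ≤ t`. -/
abbrev TimePair : Type := {p : ℝ≥0 × ℝ≥0 // p.1 ≤ p.2}

section

variable {V : Type*} [NormedAddCommGroup V] [InnerProductSpace ℝ V] [MeasurableSpace V]

/-- The probability measure `P_{s,t}(x, ·)` for `s ≤ t`. -/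
noncomputable def TransitionFunction.law {E : Set V} (P : TransitionFunction E)
    (x : WithCemetery E) (p : TimePair) : ProbabilityMeasure (WithCemetery E) :=
  ⟨P.P p.1.1 p.1.2 x, P.isProb _ _ p.2 x⟩

/-- Stochastic continuity: `P_{s,S}(x, ·) → P_{t,T}(x, ·)` weakly whenever `(s,S) → (t,T)` with
`s ≤ S` and `t ≤ T`. (`ProbabilityMeasure` carries the topology of weak convergence.) -/
def TransitionFunction.StochasticallyContinuous [BorelSpace V] {E : Set V}
    (P : TransitionFunction E) : Prop :=
  ∀ x : WithCemetery E, Continuous (P.law x)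

/-- The complexification `V + iV` of `V`; the pair `(a, b)` stands for `a + i b`. -/
abbrev Cplx (V : Type*) : Type _ := V × V

/-- The bilinear extension `⟨a + i b, x⟩ = ⟨a, x⟩ + i ⟨b, x⟩` of the scalar product. -/
noncomputable def pairing (u : Cplx V) (x : V) : ℂ :=
  (inner ℝ u.1 x : ℂ) + Complex.I * (inner ℝ u.2 x : ℂ)

/-- `f_u(x) = exp ⟨u, x⟩` on `E`, extended by `f_u(Δ) = 0`. -/
noncomputable def expFun (E : Set V) (u : Cplx V) : WithCemetery E → ℂ :=
  Sum.elim (fun x => Complex.exp (pairing u x)) (fun _ => 0)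

/-- `P_{s,t} f_u (x)`. -/
noncomputable def TransitionFunction.expInt {E : Set V} (P : TransitionFunction E)
    (s t : ℝ≥0) (u : Cplx V) (x : E) : ℂ :=
  ∫ y, expFun E u y ∂(P.P s t (Sum.inl x))

/-- `𝒰`: the `u ∈ V + iV` for which `x ↦ exp ⟨u, x⟩` is bounded on `E`. -/
def boundedExponents (E : Set V) : Set (Cplx V) :=
  {u | ∃ C : ℝ, ∀ x ∈ E, ‖Complex.exp (pairing u x)‖ ≤ C}

/-- `𝒰_k`: the `u ∈ V + iV` with `sup_{x ∈ E} |exp ⟨u, x⟩| ≤ k`. -/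
def boundedExponentsBy (E : Set V) (k : ℕ) : Set (Cplx V) :=
  {u | ∀ x ∈ E, ‖Complex.exp (pairing u x)‖ ≤ k}

/-- `{P_{s,t}}` is affine, with `P_{s,t} f_u(x) = Φ_{s,t}(u) exp ⟨ψ_{s,t}(u), x⟩` for `s ≤ t`,
`u ∈ 𝒰` and `x ∈ E`. The values of `Φ` and `ψ` off `𝒰` or for `t < s` are irrelevant. -/
def TransitionFunction.IsAffineWith {E : Set V} (P : TransitionFunction E)
    (Φ : ℝ≥0 → ℝ≥0 → Cplx V → ℂ) (ψ : ℝ≥0 → ℝ≥0 → Cplx V → Cplx V) : Prop :=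
  ∀ s t, s ≤ t → ∀ u ∈ boundedExponents E, ∀ x : E,
    P.expInt s t u x = Φ s t u * Complex.exp (pairing (ψ s t u) x)

/-- `{(t, T, u) : 0 ≤ t ≤ T, u ∈ 𝒰_k}`. -/
def timeExponents (E : Set V) (k : ℕ) : Set (ℝ≥0 × ℝ≥0 × Cplx V) :=
  {q | q.1 ≤ q.2.1 ∧ q.2.2 ∈ boundedExponentsBy E k}

/-- `𝒬_k = {(t, T, u) : 0 ≤ t ≤ T, u ∈ 𝒰_k, Φ_{v,T}(u) ≠ 0 for t ≤ v ≤ T}`. -/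
def nonvanishingDomain (E : Set V) (Φ : ℝ≥0 → ℝ≥0 → Cplx V → ℂ) (k : ℕ) :
    Set (ℝ≥0 × ℝ≥0 × Cplx V) :=
  {q | q ∈ timeExponents E k ∧ ∀ v, q.1 ≤ v → v ≤ q.2.1 → Φ v q.2.1 q.2.2 ≠ 0}

end

end AffineProcess

/-! Stochastic continuity makes `P_{t,T} f_u(x)` jointly continuous: the measures converge weakly,
and `f_u` depends on `u` uniformly on bounded parts of `E`, with the tails controlled by weak
convergence. Evaluating at `x = 0` gives `Φ`, and where `Φ ≠ 0` division gives continuity of `exp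
⟨ψ, x⟩` for each `x`. The difficulty is to recover `ψ` itself, since its imaginary part is not known
to stay bounded.

`tendsto_zero_of_tendsto_exp_inner` settles this. Let `W` be the space of `w` with `⟨b_n, w⟩ → 0`.
If `W` is proper, the projection of the connected set to `Wᗮ` is nonconstant, so its image contains
a nondegenerate continuum. Baire gives a relatively open piece of it on which `cos ⟨b_n, ·⟩ ≥ 1/2`
for all large `n`, and this piece contains a nondegenerate connected set. There `⟨b_n, ·⟩` varies by
less than `π`, so no winding is lost and differences of its points lie in `W ∩ Wᗮ = 0`, a
contradiction.

Conversely, the integrals of `exp (i ⟨v, x⟩)` determine the characteristic functions after a closed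
embedding of `E ∪ {Δ}` into `V × ℝ`, so Lévy's continuity theorem applies. -/

open Filter

/-! ### Continua and totally disconnected compact sets. -/

/-- In a compact totally disconnected set, two disjoint closed subsets can be enlarged to a
partition into two closed sets. -/
lemma IsTotallyDisconnected.exists_isClosed_partition {Y : Type*} [TopologicalSpace Y] [T2Space Y]
    {K A B : Set Y} (hK : IsCompact K) (hd : IsTotallyDisconnected K) (hA : IsClosed A)
    (hB : IsClosed B) (hAK : A ⊆ K) (hBK : B ⊆ K) (hAB : Disjoint A B) :
    ∃ A' B' : Set Y, (IsClosed A' ∧ IsClosed B' ∧ Disjoint A' B' ∧ A' ∪ B' = K) ∧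
      A ⊆ A' ∧ B ⊆ B' := by
  have := isCompact_iff_compactSpace.1 hK
  have := totallyDisconnectedSpace_subtype_iff.2 hd
  obtain ⟨S, hS, hAS, hSB⟩ := exists_clopen_of_closed_subset_open
    (X := K) (Z := (↑) ⁻¹' A) (U := ((↑) ⁻¹' B)ᶜ) (hA.preimage continuous_subtype_val)
    (hB.preimage continuous_subtype_val).isOpen_compl
    (fun x hx hx' => hAB.le_bot ⟨hx, hx'⟩)
  have hemb := hK.isClosed.isClosedEmbedding_subtypeVal
  refine ⟨(↑) '' S, (↑) '' Sᶜ, ⟨hemb.isClosedMap _ hS.1, hemb.isClosedMap _ hS.compl.1,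
    (disjoint_compl_right.image Subtype.val_injective.injOn (subset_univ _) (subset_univ _)), ?_⟩,
    ?_, ?_⟩
  · rw [← image_union, union_compl_self, image_univ, Subtype.range_coe]
  · exact fun x hx => ⟨⟨x, hAK hx⟩, hAS hx, rfl⟩
  · exact fun x hx => ⟨⟨x, hBK hx⟩, fun h => hSB h hx, rfl⟩

/-- Near each of its points, a nondegenerate continuum contains a nondegenerate connected set. -/
lemma IsPreconnected.exists_nontrivial_subset_ball {Y : Type*} [MetricSpace Y] {K : Set Y}
    (hK : IsCompact K) (hc : IsPreconnected K) (hn : K.Nontrivial) {x : Y} (hx : x ∈ K) {r : ℝ}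
    (hr : 0 < r) : ∃ T ⊆ K ∩ Metric.ball x r, IsPreconnected T ∧ T.Nontrivial := by
  by_contra! hcon
  obtain ⟨y, hy, hyx⟩ := hn.exists_ne x
  -- `ρ < r` keeps the closed ball inside the given ball; `ρ ≤ dist y x` keeps `y` out of the open
  -- `ρ`-ball.
  set ρ := min (r / 2) (dist y x) with hρ
  have hρ0 : 0 < ρ := lt_min (by linarith) (dist_pos.2 hyx)
  have hρr : ρ < r := (min_le_left _ _).trans_lt (by linarith)
  set N := K ∩ Metric.closedBall x ρ
  have hNd : IsTotallyDisconnected N := fun T hT hTc => by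
    refine hcon T (hT.trans ?_) hTc
    exact inter_subset_inter_right _ (Metric.closedBall_subset_ball hρr)
  obtain ⟨A, B, ⟨hA, hB, hAB, hABN⟩, hxA, hsB⟩ := hNd.exists_isClosed_partition
    (A := {x}) (B := K ∩ Metric.sphere x ρ) (hK.inter_right Metric.isClosed_closedBall)
    isClosed_singleton (hK.isClosed.inter Metric.isClosed_sphere)
    (singleton_subset_iff.2 ⟨hx, Metric.mem_closedBall_self hρ0.le⟩)
    (inter_subset_inter_right _ Metric.sphere_subset_closedBall)
    (disjoint_singleton_left.2 fun h => by simp [hρ0.ne] at h)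
  -- `A` misses the sphere, so adding the outside of the ball to `B` separates `x` from `y` in `K`.
  have hcl : IsClosed (B ∪ {z | ρ ≤ dist z x}) :=
    hB.union (isClosed_le continuous_const (continuous_id.dist continuous_const))
  obtain ⟨z, hzK, hzA, hzB⟩ := isPreconnected_closed_iff.1 hc A _ hA hcl
    (fun z hz => by
      rcases le_total ρ (dist z x) with h | h
      · exact Or.inr (Or.inr h)
      · rcases hABN.ge ⟨hz, h⟩ with h' | h'
        · exact Or.inl h'
        · exact Or.inr (Or.inl h'))
    ⟨x, hx, hxA rfl⟩ ⟨y, hy, Or.inr (show ρ ≤ dist y x from min_le_right _ _)⟩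
  rcases hzB with hzB | hzB
  · exact hAB.le_bot ⟨hzA, hzB⟩
  · have : z ∈ N := hABN.le (Or.inl hzA)
    exact hAB.le_bot ⟨hzA, hsB ⟨hzK, le_antisymm this.2 hzB⟩⟩

/-- If a continuous map is not constant on a closed connected subset of a proper space, then the
image of this set contains a nondegenerate continuum. -/
lemma IsPreconnected.exists_continuum_subset_image {X Y : Type*} [PseudoMetricSpace X]
    [ProperSpace X] [MetricSpace Y] {C : Set X} (hC : IsClosed C) (hc : IsPreconnected C)
    {f : X → Y} (hf : Continuous f) (hn : (f '' C).Nontrivial) :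
    ∃ K ⊆ f '' C, IsCompact K ∧ IsPreconnected K ∧ K.Nontrivial := by
  by_contra! hcon
  obtain ⟨_, ⟨x, hx, rfl⟩, _, ⟨y, hy, rfl⟩, hxy⟩ := hn
  set S : ℕ → Set X := fun n => C ∩ Metric.closedBall x (dist y x + n) with hSdef
  -- `f '' C` need not be closed, so it is exhausted by compact pieces, the first containing both `f
  -- x` and `f y`. Without a continuum these are totally disconnected; nested partitions of them
  -- would disconnect `C`.
  have hS : ∀ n, IsCompact (f '' S n) := fun n =>
    ((isCompact_closedBall _ _).inter_left hC).image hf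
  have hSmono : ∀ n, S n ⊆ S (n + 1) := fun n =>
    inter_subset_inter_right _ (Metric.closedBall_subset_closedBall (by push_cast; linarith))
  have hd : ∀ n, IsTotallyDisconnected (f '' S n) := fun n T hT hTc => by
    have hTS : closure T ⊆ f '' S n := closure_minimal hT (hS n).isClosed
    exact (hcon _ (hTS.trans (image_mono inter_subset_left))
      ((hS n).of_isClosed_subset isClosed_closure hTS) hTc.closure).anti subset_closure
  let valid : ℕ → Set Y × Set Y → Prop := fun n p =>
    IsClosed p.1 ∧ IsClosed p.2 ∧ Disjoint p.1 p.2 ∧ p.1 ∪ p.2 = f '' S n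
  have hstep : ∀ n p, valid n p → ∃ q, valid (n + 1) q ∧ p.1 ⊆ q.1 ∧ p.2 ⊆ q.2 := by
    rintro n p ⟨h1, h2, h3, h4⟩
    have h5 := image_mono (f := f) (hSmono n)
    rw [← h4] at h5
    obtain ⟨A, B, h, hA, hB⟩ := (hd (n + 1)).exists_isClosed_partition (hS _) h1 h2
      (subset_union_left.trans h5) (subset_union_right.trans h5) h3
    exact ⟨(A, B), h, hA, hB⟩
  choose! g hgv hg1 hg2 using hstep
  obtain ⟨A₀, B₀, h₀, hxA, hyB⟩ := (hd 0).exists_isClosed_partition (A := {f x}) (B := {f y}) (hS 0)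
    isClosed_singleton isClosed_singleton
    (singleton_subset_iff.2 ⟨x, ⟨hx, by simp⟩, rfl⟩)
    (singleton_subset_iff.2 ⟨y, ⟨hy, by simp⟩, rfl⟩) (disjoint_singleton.2 hxy)
  let p : ℕ → Set Y × Set Y := fun n => Nat.rec (A₀, B₀) (fun n q => g n q) n
  have hp : ∀ n, valid n (p n) := fun n => by
    induction n with
    | zero => exact h₀
    | succ n ih => exact hgv n _ ih
  have hp1 : Monotone fun n => (p n).1 := monotone_nat_of_le_succ fun n => hg1 n _ (hp n)
  have hp2 : Monotone fun n => (p n).2 := monotone_nat_of_le_succ fun n => hg2 n _ (hp n)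
  have hdisj : ∀ m n, Disjoint (p m).1 (p n).2 := fun m n =>
    (hp (max m n)).2.2.1.mono (hp1 (le_max_left _ _)) (hp2 (le_max_right _ _))
  have hcov : ∀ n, ∀ z ∈ S n, f z ∈ (p n).1 ∨ f z ∈ (p n).2 := fun n z hz =>
    (hp n).2.2.2.ge (mem_image_of_mem f hz)
  have hball : ∀ z ∈ C, ∃ n, ∃ U ∈ 𝓝 z, C ∩ U ⊆ S n := fun z hz => by
    obtain ⟨n, hn⟩ := exists_nat_gt (dist z x - dist y x)
    exact ⟨n, Metric.closedBall x (dist y x + n),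
      Metric.closedBall_mem_nhds_of_mem (by rw [Metric.mem_ball]; linarith), subset_rfl⟩
  -- Near a point of `C` a single stage decides membership, so the increasing union stays closed.
  have hclosed : ∀ D : ℕ → Set Y, (∀ n, IsClosed (D n)) →
      (∀ n, ∀ z ∈ S n, ∀ m, f z ∈ D m → f z ∈ D n) → IsClosed (C ∩ ⋃ n, f ⁻¹' D n) := by
    intro D hD hDS
    refine isClosed_of_closure_subset fun z hz => ?_
    have hzC : z ∈ C := hC.closure_subset (closure_mono inter_subset_left hz)
    obtain ⟨n, U, hU, hUS⟩ := hball z hzC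
    refine ⟨hzC, mem_iUnion.2 ⟨n, ?_⟩⟩
    have hz' : z ∈ closure (f ⁻¹' D n) := by
      rw [mem_closure_iff_nhds] at hz ⊢
      intro O hO
      obtain ⟨w, hwO, hwC, hw⟩ := hz (O ∩ U) (inter_mem hO hU)
      obtain ⟨m, hm⟩ := mem_iUnion.1 hw
      exact ⟨w, hwO.1, hDS n w (hUS ⟨hwC, hwO.2⟩) m hm⟩
    exact ((hD n).preimage hf).closure_subset hz'
  obtain ⟨z, -, ⟨-, hz1⟩, -, hz2⟩ := isPreconnected_closed_iff.1 hc _ _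
    (hclosed (fun n => (p n).1) (fun n => (hp n).1) fun n z hz m hm =>
      (hcov n z hz).resolve_right fun h => (hdisj m n).le_bot ⟨hm, h⟩)
    (hclosed (fun n => (p n).2) (fun n => (hp n).2.1) fun n z hz m hm =>
      (hcov n z hz).resolve_left fun h => (hdisj n m).le_bot ⟨h, hm⟩)
    (fun z hz => by
      obtain ⟨n, U, hU, hUS⟩ := hball z hz
      rcases hcov n z (hUS ⟨hz, mem_of_mem_nhds hU⟩) with h | h
      · exact Or.inl ⟨hz, mem_iUnion.2 ⟨n, h⟩⟩
      · exact Or.inr ⟨hz, mem_iUnion.2 ⟨n, h⟩⟩)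
    ⟨x, hx, hx, mem_iUnion.2 ⟨0, hxA rfl⟩⟩ ⟨y, hy, hy, mem_iUnion.2 ⟨0, hyB rfl⟩⟩
  obtain ⟨m, hm⟩ := mem_iUnion.1 hz1
  obtain ⟨n, hn⟩ := mem_iUnion.1 hz2
  exact (hdisj m n).le_bot ⟨hm, hn⟩

/-! ### Recovering exponents from exponentials. -/

/-- Weak convergence implies convergence in finite dimension. -/
lemma tendsto_of_forall_tendsto_inner {V ι : Type*} [NormedAddCommGroup V] [InnerProductSpace ℝ V]
    [FiniteDimensional ℝ V] {l : Filter ι} {b : ι → V} {c : V}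
    (h : ∀ w, Tendsto (fun n => inner ℝ (b n) w) l (𝓝 (inner ℝ c w))) : Tendsto b l (𝓝 c) := by
  have e := stdOrthonormalBasis ℝ V
  have h' : ∀ v, v = ∑ i, inner ℝ v (e i) • e i := fun v => by
    conv_lhs => rw [← e.sum_repr' v]
    simp_rw [real_inner_comm]
  rw [h' c, funext fun n => h' (b n)]
  exact tendsto_finsetSum _ fun i _ => (h _).smul_const _

/-- The vectors `w` with `⟨b_n, w⟩ → ⟨c, w⟩` form a subspace. -/
lemma tendsto_inner_of_mem_span {V ι : Type*} [NormedAddCommGroup V] [InnerProductSpace ℝ V]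
    {l : Filter ι} {b : ι → V} {c : V} {s : Set V}
    (h : ∀ w ∈ s, Tendsto (fun n => inner ℝ (b n) w) l (𝓝 (inner ℝ c w))) {w : V}
    (hw : w ∈ Submodule.span ℝ s) : Tendsto (fun n => inner ℝ (b n) w) l (𝓝 (inner ℝ c w)) := by
  induction hw using Submodule.span_induction with
  | mem x hx => exact h x hx
  | zero => simpa using tendsto_const_nhds
  | add x y _ _ hx hy => simpa only [inner_add_right] using hx.add hy
  | smul a x _ hx => simpa only [real_inner_smul_right] using hx.const_mul a

/-- On a connected set where `cos ∘ g` is positive, `g` varies by less than `π`. -/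
lemma IsPreconnected.abs_sub_lt_pi_of_cos_pos {X : Type*} [TopologicalSpace X] {T : Set X}
    (hT : IsPreconnected T) {g : X → ℝ} (hg : Continuous g) (h : ∀ x ∈ T, 0 < Real.cos (g x))
    {x y : X} (hx : x ∈ T) (hy : y ∈ T) : |g x - g y| < Real.pi := by
  wlog hxy : g y ≤ g x generalizing x y
  · rw [abs_sub_comm]
    exact this hy hx (le_of_not_ge hxy)
  rw [abs_of_nonneg (sub_nonneg.2 hxy)]
  by_contra! hcon
  -- A variation of at least `π` would force the value `g y + π`, where the cosine has the opposite
  -- sign.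
  obtain ⟨z, hz, hzg⟩ := hT.intermediate_value hy hx hg.continuousOn
    (show g y + Real.pi ∈ Icc (g y) (g x) from ⟨by linarith [Real.pi_pos], by linarith⟩)
  have h1 := h z hz
  rw [hzg, Real.cos_add_pi] at h1
  linarith [h y hy]

/-- The bound makes `θ n` the principal argument, and `arg` is continuous at `1`. -/
lemma tendsto_zero_of_tendsto_exp_mul_I {ι : Type*} {l : Filter ι} {θ : ι → ℝ}
    (h : Tendsto (fun n => Complex.exp (θ n * Complex.I)) l (𝓝 1))
    (hθ : ∀ᶠ n in l, |θ n| < Real.pi) : Tendsto θ l (𝓝 0) := by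
  have h1 := (Complex.continuousAt_arg Complex.one_mem_slitPlane).tendsto.comp h
  rw [Complex.arg_one] at h1
  refine h1.congr' ?_
  filter_upwards [hθ] with n hn
  rw [abs_lt] at hn
  rw [Function.comp_apply, Complex.exp_mul_I, Complex.arg_cos_add_sin_mul_I ⟨hn.1, hn.2.le⟩]

/-- If `exp (i ⟨b_n, x⟩) → 1` for all `x` in a closed connected set that is not contained in a
proper affine subspace, then `b_n → 0`. -/
theorem tendsto_zero_of_tendsto_exp_inner {V : Type*} [NormedAddCommGroup V]
    [InnerProductSpace ℝ V] [FiniteDimensional ℝ V] {C : Set V} (hC : IsClosed C)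
    (hc : IsPreconnected C) {x₀ : V} (hx₀ : x₀ ∈ C)
    (hspan : Submodule.span ℝ ((fun x => x - x₀) '' C) = ⊤) {b : ℕ → V}
    (hb : ∀ x ∈ C, Tendsto (fun n => Complex.exp ((inner ℝ (b n) x : ℝ) * Complex.I)) atTop (𝓝 1)) :
    Tendsto b atTop (𝓝 0) := by
  let W : Submodule ℝ V :=
    { carrier := {w | Tendsto (fun n => inner ℝ (b n) w) atTop (𝓝 0)}
      add_mem' := fun {x y} hx hy => by simpa [inner_add_right] using Tendsto.add hx hy
      zero_mem' := by simp
      smul_mem' := fun a x hx => by simpa [real_inner_smul_right] using Tendsto.const_mul a hx }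
  suffices hW : W = ⊤ by
    refine tendsto_of_forall_tendsto_inner fun w => ?_
    have : w ∈ W := hW ▸ Submodule.mem_top
    rw [inner_zero_left]
    exact this
  by_contra hW
  let f : V → V := fun x => Wᗮ.starProjection (x - x₀)
  have hf : Continuous f := by fun_prop
  have hfW : ∀ x, f x ∈ Wᗮ := fun x => Submodule.starProjection_apply_mem _ _
  have hn : (f '' C).Nontrivial := by
    by_contra hcon
    refine hW (top_le_iff.1 (hspan ▸ Submodule.span_le.2 ?_))
    rintro _ ⟨x, hx, rfl⟩
    have h1 : f x = f x₀ := not_nontrivial_iff.1 hcon (mem_image_of_mem f hx) (mem_image_of_mem f hx₀)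
    have h2 : Wᗮ.starProjection (x - x₀) = 0 := by simpa [f] using h1
    rwa [Submodule.starProjection_apply_eq_zero_iff, Submodule.orthogonal_orthogonal] at h2
  -- The base point and the `W`-component both contribute factors tending to `1`.
  have hlim : ∀ y ∈ f '' C,
      Tendsto (fun n => Complex.exp ((inner ℝ (b n) y : ℝ) * Complex.I)) atTop (𝓝 1) := by
    rintro _ ⟨x, hx, rfl⟩
    have hw : Tendsto (fun n => inner ℝ (b n) (W.starProjection (x - x₀))) atTop (𝓝 0) :=
      W.starProjection_apply_mem (x - x₀)
    have hw' : Tendsto (fun n => Complex.exp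
        ((inner ℝ (b n) (W.starProjection (x - x₀)) : ℝ) * Complex.I)) atTop (𝓝 1) := by
      have : Continuous fun r : ℝ => Complex.exp (r * Complex.I) := by fun_prop
      have h1 := (this.tendsto 0).comp hw
      rwa [Complex.ofReal_zero, zero_mul, Complex.exp_zero] at h1
    have h1 := ((hb x hx).div (hb x₀ hx₀) one_ne_zero).div hw' one_ne_zero
    rw [div_one, div_one] at h1
    refine h1.congr fun n => ?_
    have h2 : f x = x - x₀ - W.starProjection (x - x₀) := by
      simp only [f, Submodule.starProjection_orthogonal_val]
    rw [h2, Pi.div_apply, Pi.div_apply, ← Complex.exp_sub, ← Complex.exp_sub]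
    simp only [inner_sub_right, Complex.ofReal_sub]
    ring_nf
  obtain ⟨K, hKC, hKc, hKp, hKn⟩ := hc.exists_continuum_subset_image hC hf hn
  have : CompactSpace K := isCompact_iff_compactSpace.1 hKc
  have : Nonempty K := hKn.nonempty.to_subtype
  -- Baire on the compact `K` makes the threshold `N` uniform on an open piece.
  obtain ⟨N, x, hx⟩ := nonempty_interior_of_iUnion_of_closed
    (f := fun N : ℕ => {y : K | ∀ n ≥ N, 1 / 2 ≤ Real.cos (inner ℝ (b n) (y : V))})
    (fun N => by
      simp only [ofPred_forall]
      exact isClosed_iInter fun n => isClosed_iInter fun _ =>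
        isClosed_le continuous_const (by fun_prop))
    (eq_univ_of_forall fun y => by
      have h1 := (Complex.continuous_re.tendsto 1).comp (hlim y (hKC y.2))
      obtain ⟨N, hN⟩ := eventually_atTop.1 (h1.eventually_const_le
        (show (1 / 2 : ℝ) < Complex.re 1 by norm_num))
      refine mem_iUnion.2 ⟨N, fun n hn => ?_⟩
      have h2 := hN n hn
      rwa [Function.comp_apply, Complex.exp_ofReal_mul_I_re] at h2)
  obtain ⟨r, hr, hball⟩ := Metric.isOpen_iff.1 isOpen_interior x hx
  obtain ⟨T, hT, hTp, y, hy, z, hz, hyz⟩ :=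
    hKp.exists_nontrivial_subset_ball hKc hKn x.2 hr
  have hcos : ∀ n ≥ N, ∀ y ∈ T, 0 < Real.cos (inner ℝ (b n) y) := fun n hn y hy => by
    have h1 : 1 / 2 ≤ Real.cos (inner ℝ (b n) y) :=
      interior_subset (hball (show (⟨y, (hT hy).1⟩ : K) ∈ Metric.ball x r from (hT hy).2)) n hn
    linarith
  have hyW : y - z ∈ W := by
    refine tendsto_zero_of_tendsto_exp_mul_I ?_ (eventually_atTop.2 ⟨N, fun n hn => ?_⟩)
    · have h1 := (hlim y (hKC (hT hy).1)).div (hlim z (hKC (hT hz).1)) one_ne_zero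
      rw [div_one] at h1
      refine h1.congr fun n => ?_
      rw [Pi.div_apply, ← Complex.exp_sub, inner_sub_right, Complex.ofReal_sub, sub_mul]
    · rw [inner_sub_right]
      exact hTp.abs_sub_lt_pi_of_cos_pos (g := fun y => inner ℝ (b n) y) (by fun_prop)
        (hcos n hn) hy hz
  obtain ⟨y', -, rfl⟩ := hKC (hT hy).1
  obtain ⟨z', -, rfl⟩ := hKC (hT hz).1
  have h0 := Submodule.inner_right_of_mem_orthogonal hyW (Wᗮ.sub_mem (hfW y') (hfW z'))
  exact hyz (sub_eq_zero.1 (inner_self_eq_zero.1 h0))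

/-! ### Weak convergence. -/

/-- Integrals of uniformly bounded continuous functions against weakly convergent probability
measures converge when the functions converge uniformly on the sublevel sets of a continuous
function. -/
lemma MeasureTheory.ProbabilityMeasure.tendsto_integral_of_tendstoUniformlyOn {X ι : Type*}
    [TopologicalSpace X] [MeasurableSpace X] [OpensMeasurableSpace X] {l : Filter ι}
    {μ : ι → ProbabilityMeasure X} {μ₀ : ProbabilityMeasure X} (hμ : Tendsto μ l (𝓝 μ₀))
    {ρ : X → ℝ} (hρ : Continuous ρ) {F : ι → X → ℂ} {f : X → ℂ} (hF : ∀ i, Continuous (F i))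
    (hf : Continuous f) {k : ℝ} (hFk : ∀ i x, ‖F i x‖ ≤ k) (hfk : ∀ x, ‖f x‖ ≤ k)
    (hu : ∀ m : ℕ, TendstoUniformlyOn F f l {x | ρ x ≤ m}) :
    Tendsto (fun i => ∫ x, F i x ∂(μ i : Measure X)) l (𝓝 (∫ x, f x ∂(μ₀ : Measure X))) := by
  have hint : ∀ (ν : ProbabilityMeasure X) (g : X → ℂ), Continuous g → (∀ x, ‖g x‖ ≤ k) →
      Integrable g (ν : Measure X) := fun ν g hg hgk =>
    (integrable_const k).mono' hg.measurable.aestronglyMeasurable (ae_of_all _ hgk)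
  -- A continuous cutoff, `0` for `ρ ≤ m` and `1` for `ρ ≥ m + 1`: it bounds the tail mass and can
  -- be tested against weak convergence.
  let η : ℕ → BoundedContinuousFunction X ℝ := fun m =>
    BoundedContinuousFunction.ofNormedAddCommGroup (fun x => max 0 (min 1 (ρ x - m)))
      (by fun_prop) 1 fun x => by
        rw [Real.norm_of_nonneg (le_max_left _ _)]
        exact max_le zero_le_one (min_le_left _ _)
  have hη : ∀ m x, η m x = max 0 (min 1 (ρ x - m)) := fun _ _ => rfl
  have hη0 : Tendsto (fun m => ∫ x, η m x ∂(μ₀ : Measure X)) atTop (𝓝 0) := by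
    have h1 : Tendsto (fun m => ∫ x, η m x ∂(μ₀ : Measure X)) atTop
        (𝓝 (∫ _, (0 : ℝ) ∂(μ₀ : Measure X))) := by
      refine tendsto_integral_of_dominated_convergence (fun _ => 1)
        (fun m => (η m).continuous.measurable.aestronglyMeasurable) (integrable_const _)
        (fun m => ae_of_all _ fun x => ?_) (ae_of_all _ fun x => ?_)
      · rw [hη, Real.norm_of_nonneg (le_max_left _ _)]
        exact max_le zero_le_one (min_le_left _ _)
      · obtain ⟨N, hN⟩ := exists_nat_ge (ρ x)
        refine tendsto_const_nhds.congr' ?_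
        filter_upwards [eventually_ge_atTop N] with n hn
        have : (N : ℝ) ≤ n := Nat.cast_le.2 hn
        rw [hη, max_eq_left]
        exact (min_le_right _ _).trans (by linarith)
    simpa using h1
  have hfl : Tendsto (fun i => ∫ x, f x ∂(μ i : Measure X)) l (𝓝 (∫ x, f x ∂(μ₀ : Measure X))) :=
    (ProbabilityMeasure.tendsto_iff_forall_integral_rclike_tendsto ℂ).1 hμ
      (BoundedContinuousFunction.ofNormedAddCommGroup f hf k hfk)
  suffices hdiff : Tendsto (fun i => ∫ x, F i x ∂(μ i : Measure X) - ∫ x, f x ∂(μ i : Measure X)) l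
      (𝓝 0) by simpa using hdiff.add hfl
  rw [Metric.tendsto_nhds]
  intro ε hε
  have hη0' : Tendsto (fun m => 2 * k * ∫ x, η m x ∂(μ₀ : Measure X)) atTop (𝓝 0) := by
    simpa using hη0.const_mul (2 * k)
  obtain ⟨m, hm⟩ := (hη0'.eventually_lt_const (show 0 < ε / 2 by linarith)).exists
  have hηl : Tendsto (fun i => 2 * k * ∫ x, η m x ∂(μ i : Measure X)) l
      (𝓝 (2 * k * ∫ x, η m x ∂(μ₀ : Measure X))) :=
    ((ProbabilityMeasure.tendsto_iff_forall_integral_tendsto.1 hμ) (η m)).const_mul _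
  filter_upwards [hηl.eventually_lt_const hm,
    Metric.tendstoUniformlyOn_iff.1 (hu (m + 1)) (ε / 2) (by linarith)] with i hi1 hi2
  rw [dist_zero_right, ← integral_sub (hint _ _ (hF i) (hFk i)) (hint _ _ hf hfk)]
  have hηint : Integrable (fun x => 2 * k * η m x) (μ i : Measure X) :=
    ((η m).integrable _).const_mul _
  calc ‖∫ x, (F i x - f x) ∂(μ i : Measure X)‖
      ≤ ∫ x, (ε / 2 + 2 * k * η m x) ∂(μ i : Measure X) := by
        refine norm_integral_le_of_norm_le ((integrable_const _).add hηint) (ae_of_all _ fun x => ?_)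
        have hk : 0 ≤ k := (norm_nonneg _).trans (hfk x)
        have hηx : 0 ≤ η m x := le_max_left _ _
        rcases le_or_gt (ρ x) (m + 1) with h | h
        · have h1 := hi2 x (by simpa using h)
          rw [dist_comm, dist_eq_norm] at h1
          nlinarith [mul_nonneg hk hηx]
        · have h1 : η m x = 1 := by
            rw [hη, min_eq_left (by linarith), max_eq_right zero_le_one]
          rw [h1]
          linarith [norm_sub_le (F i x) (f x), hFk i x, hfk x]
    _ = ε / 2 + 2 * k * ∫ x, η m x ∂(μ i : Measure X) := by
        rw [integral_add (integrable_const _) hηint, integral_const_mul]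
        simp
    _ < ε := by linarith

/-- Weak convergence can be tested after a closed embedding into a normal space. -/
lemma Topology.IsClosedEmbedding.tendsto_probabilityMeasure {X Y ι : Type*} [TopologicalSpace X]
    [MeasurableSpace X] [OpensMeasurableSpace X] [TopologicalSpace Y] [NormalSpace Y]
    [MeasurableSpace Y] [BorelSpace Y] {j : X → Y} (hj : IsClosedEmbedding j) {l : Filter ι}
    {μ : ι → ProbabilityMeasure X} {μ₀ : ProbabilityMeasure X}
    (h : Tendsto (fun i => (μ i).map hj.continuous.measurable.aemeasurable) l
      (𝓝 (μ₀.map hj.continuous.measurable.aemeasurable))) : Tendsto μ l (𝓝 μ₀) := by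
  rw [ProbabilityMeasure.tendsto_iff_forall_integral_tendsto] at h ⊢
  intro f
  obtain ⟨g, -, hgf⟩ := BoundedContinuousFunction.exists_extension_norm_eq_of_isClosedEmbedding f hj
  have hg : ∀ ν : ProbabilityMeasure X,
      ∫ y, g y ∂((ν.map hj.continuous.measurable.aemeasurable : ProbabilityMeasure Y) : Measure Y) =
        ∫ x, f x ∂(ν : Measure X) := fun ν => by
    rw [ProbabilityMeasure.toMeasure_map, MeasureTheory.integral_map hj.continuous.measurable.aemeasurable
      g.continuous.measurable.aestronglyMeasurable, ← hgf]
    rfl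
  simpa only [hg] using h g

/-! ### The space with cemetery and its characteristic functions. -/

namespace AffineProcess

/-- The embedding of `E ∪ {Δ}` into `V × ℝ` that sends `x ∈ E` to `(x, 0)` and `Δ` to `(0, 1)`. -/
noncomputable def cemeteryEmbedding {V : Type*} [Zero V] (E : Set V) : WithCemetery E → WithLp 2 (V × ℝ) :=
  Sum.elim (fun x => WithLp.toLp 2 ((x : V), 0)) fun _ => WithLp.toLp 2 (0, 1)

lemma isClosedEmbedding_cemeteryEmbedding {V : Type*} [NormedAddCommGroup V] {E : Set V} (hE : IsClosed E) :
    IsClosedEmbedding (cemeteryEmbedding E) := by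
  have hc : IsClosedEmbedding fun x : E => WithLp.toLp 2 ((x : V), (0 : ℝ)) := by
    have h1 : IsClosedEmbedding fun v : V => (v, (0 : ℝ)) :=
      .of_continuous_injective_isClosedMap (by fun_prop) (Prod.mk_left_injective _)
        fun S hS => by simpa [← prod_singleton] using hS.prod isClosed_singleton
    exact (WithLp.homeomorphProd 2 V ℝ).symm.isClosedEmbedding.comp
      (h1.comp hE.isClosedEmbedding_subtypeVal)
  refine .of_continuous_injective_isClosedMap (hc.continuous.sumElim continuous_const)
    (hc.injective.sumElim (Function.injective_of_subsingleton _) fun x _ h => ?_)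
    (hc.isClosedMap.sumElim fun S _ => (S.toFinite.image _).isClosed)
  have h1 := congrArg WithLp.snd h
  simp at h1

variable {V : Type*} [NormedAddCommGroup V] [InnerProductSpace ℝ V]

lemma continuous_pairing : Continuous fun p : Cplx V × V => pairing p.1 p.2 := by
  unfold pairing
  fun_prop

lemma norm_exp_pairing (u : Cplx V) (x : V) :
    ‖Complex.exp (pairing u x)‖ = Real.exp (inner ℝ u.1 x) := by
  simp [Complex.norm_exp, pairing]

lemma pairing_zero_right (u : Cplx V) : pairing u 0 = 0 := by simp [pairing]

lemma exp_pairing_zero_left (v x : V) :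
    Complex.exp (pairing (0, v) x) = Complex.exp ((inner ℝ v x : ℝ) * Complex.I) := by
  simp [pairing, mul_comm]

lemma continuous_expFun (E : Set V) (u : Cplx V) : Continuous (expFun E u) := by
  refine Continuous.sumElim ?_ continuous_const
  have := continuous_pairing (V := V)
  fun_prop

lemma norm_expFun_le {E : Set V} {u : Cplx V} {k : ℕ} (hu : u ∈ boundedExponentsBy E k)
    (y : WithCemetery E) : ‖expFun E u y‖ ≤ k := by
  rcases y with x | _
  · exact hu x x.2
  · simp [expFun]

lemma zero_prod_mem_boundedExponentsBy (E : Set V) (v : V) : (0, v) ∈ boundedExponentsBy E 1 :=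
  fun x _ => by simp [norm_exp_pairing]

lemma mem_boundedExponents {E : Set V} {u : Cplx V} {k : ℕ} (hu : u ∈ boundedExponentsBy E k) :
    u ∈ boundedExponents E := ⟨k, hu⟩

variable [FiniteDimensional ℝ V]

/-- Joint continuity of the exponential gives continuity in `u` for the compact-open topology, and
closed balls are compact. -/
lemma tendstoUniformlyOn_expFun {ι : Type*} {l : Filter ι} {u : ι → Cplx V} {u₀ : Cplx V}
    (hu : Tendsto u l (𝓝 u₀)) (E : Set V) (r : ℝ) :
    TendstoUniformlyOn (fun i => expFun E (u i)) (expFun E u₀) l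
      {y | Sum.elim (fun x : E => ‖(x : V)‖) (fun _ => 0) y ≤ r} := by
  let G : C(Cplx V × V, ℂ) :=
    ⟨fun p => Complex.exp (pairing p.1 p.2), Complex.continuous_exp.comp continuous_pairing⟩
  have h1 := ContinuousMap.tendsto_iff_forall_isCompact_tendstoUniformlyOn.1
    ((G.curry.continuous.tendsto u₀).comp hu) _ (isCompact_closedBall (0 : V) r)
  rw [Metric.tendstoUniformlyOn_iff] at h1 ⊢
  intro ε hε
  filter_upwards [h1 ε hε] with i hi y hy
  rcases y with x | _
  · exact hi x (mem_closedBall_zero_iff.2 hy)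
  · simpa [expFun] using hε

variable [MeasurableSpace V] [BorelSpace V]

/-- Probability measures on `E ∪ {Δ}` converge weakly if the integrals of the functions
`exp (i ⟨v, x⟩)`, extended by zero, converge. -/
lemma tendsto_of_tendsto_integral_expFun {E : Set V} (hE : IsClosed E)
    {μ : ℕ → ProbabilityMeasure (WithCemetery E)} {μ₀ : ProbabilityMeasure (WithCemetery E)}
    (h : ∀ v : V, Tendsto (fun n => ∫ y, expFun E (0, v) y ∂(μ n : Measure (WithCemetery E))) atTop
      (𝓝 (∫ y, expFun E (0, v) y ∂(μ₀ : Measure (WithCemetery E))))) :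
    Tendsto μ atTop (𝓝 μ₀) := by
  have hj := isClosedEmbedding_cemeteryEmbedding hE
  refine hj.tendsto_probabilityMeasure (ProbabilityMeasure.tendsto_of_tendsto_charFun fun t => ?_)
  have hint : ∀ (ν : ProbabilityMeasure (WithCemetery E)) (v : V),
      Integrable (expFun E (0, v)) (ν : Measure (WithCemetery E)) := fun ν v =>
    (integrable_const ((1 : ℕ) : ℝ)).mono' (continuous_expFun E _).measurable.aestronglyMeasurable
      (ae_of_all _ (norm_expFun_le (zero_prod_mem_boundedExponentsBy E v)))
  -- `f_0` is the indicator of `E`, so `1 - ∫ f_0` is the mass at `Δ`, where the character equals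
  -- `exp (i t.snd)`.
  have hchar : ∀ ν : ProbabilityMeasure (WithCemetery E),
      charFun (ν.map hj.continuous.measurable.aemeasurable : ProbabilityMeasure _).toMeasure t =
        ∫ y, expFun E (0, t.fst) y ∂(ν : Measure (WithCemetery E)) +
          Complex.exp (t.snd * Complex.I) *
            (1 - ∫ y, expFun E (0, 0) y ∂(ν : Measure (WithCemetery E))) := fun ν => by
    rw [charFun_apply, ProbabilityMeasure.toMeasure_map,
      integral_map hj.continuous.measurable.aemeasurable (by fun_prop)]
    have h1 : (1 : ℂ) = ∫ _, 1 ∂(ν : Measure (WithCemetery E)) := by simp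
    rw [h1, ← integral_sub (integrable_const _) (hint ν 0), ← integral_const_mul,
      ← integral_add (hint ν _) (Integrable.const_mul (f := fun y => 1 - expFun E (0, 0) y)
        ((integrable_const _).sub (hint ν 0)) _)]
    refine integral_congr_ae (ae_of_all _ fun y => ?_)
    rcases y with x | _
    · simp [cemeteryEmbedding, expFun, exp_pairing_zero_left, real_inner_comm]
    · simp [cemeteryEmbedding, expFun]
  simp only [hchar]
  exact (h _).add (((h 0).const_sub 1).const_mul _)

end AffineProcess

/-! ### Affine transition functions. -/

namespace AffineProcess

variable {V : Type*} [NormedAddCommGroup V] [InnerProductSpace ℝ V]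

lemma span_sub_eq_top_of_affineBasis {ι : Type*} (b : AffineBasis ι ℝ V) {C : Set V}
    (hb : ∀ i, b i ∈ C) {x₀ : V} (hx₀ : x₀ ∈ C) :
    Submodule.span ℝ ((fun x => x - x₀) '' C) = ⊤ := by
  have h1 : affineSpan ℝ C = ⊤ :=
    top_le_iff.1 (b.tot ▸ affineSpan_mono ℝ (range_subset_iff.2 hb))
  rw [← AffineSubspace.direction_top ℝ V V, ← h1, direction_affineSpan,
    vectorSpan_eq_span_vsub_set_right ℝ hx₀]
  rfl

lemma TransitionFunction.IsAffineWith.eq_expInt_zero [MeasurableSpace V] {E : Set V}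
    {P : TransitionFunction E} {Φ : ℝ≥0 → ℝ≥0 → Cplx V → ℂ} {ψ : ℝ≥0 → ℝ≥0 → Cplx V → Cplx V}
    (haff : P.IsAffineWith Φ ψ)
    (h0 : (0 : V) ∈ E) {s t : ℝ≥0} (hst : s ≤ t) {u : Cplx V} (hu : u ∈ boundedExponents E) :
    Φ s t u = P.expInt s t u ⟨0, h0⟩ := by
  rw [haff s t hst u hu, pairing_zero_right, Complex.exp_zero, mul_one]

lemma TransitionFunction.expInt_self [MeasurableSpace V] [BorelSpace V] {E : Set V}
    (P : TransitionFunction E) (s : ℝ≥0) (u : Cplx V) (x : E) :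
    P.expInt s s u x = Complex.exp (pairing u x) := by
  rw [TransitionFunction.expInt, P.diag,
    integral_dirac' _ _ (continuous_expFun E u).measurable.stronglyMeasurable]
  rfl

variable [FiniteDimensional ℝ V]

/-- Pointwise convergence of exponentials on a closed connected set that is not contained in a
proper affine subspace implies convergence of the exponents. -/
lemma tendsto_of_tendsto_exp_pairing {C : Set V} (hC : IsClosed C) (hc : IsPreconnected C) {x₀ : V}
    (hx₀ : x₀ ∈ C) (hspan : Submodule.span ℝ ((fun x => x - x₀) '' C) = ⊤) {w : ℕ → Cplx V}
    {w₀ : Cplx V} (h : ∀ x ∈ C, Tendsto (fun n => Complex.exp (pairing (w n) x)) atTop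
      (𝓝 (Complex.exp (pairing w₀ x)))) : Tendsto w atTop (𝓝 w₀) := by
  have hre : ∀ x ∈ C, Tendsto (fun n => inner ℝ (w n).1 x) atTop (𝓝 (inner ℝ w₀.1 x)) :=
    fun x hx => by
      -- The modulus sees only the real part of the exponent, which a logarithm recovers.
      have h1 := (h x hx).norm
      simp only [norm_exp_pairing] at h1
      simpa using h1.log (Real.exp_pos _).ne'
  suffices h' : Tendsto (fun n => (w n).1) atTop (𝓝 w₀.1) ∧ Tendsto (fun n => (w n).2) atTop (𝓝 w₀.2)
    from h'.1.prodMk_nhds h'.2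
  refine ⟨tendsto_of_forall_tendsto_inner fun v => ?_, ?_⟩
  · refine tendsto_inner_of_mem_span (s := (fun x => x - x₀) '' C) ?_ (hspan ▸ Submodule.mem_top)
    rintro _ ⟨x, hx, rfl⟩
    simpa only [inner_sub_right] using (hre x hx).sub (hre x₀ hx₀)
  · rw [← tendsto_sub_nhds_zero_iff]
    refine tendsto_zero_of_tendsto_exp_inner hC hc hx₀ hspan fun x hx => ?_
    have hre' : Tendsto (fun n => Complex.exp ((inner ℝ (w n).1 x : ℝ) : ℂ)) atTop
        (𝓝 (Complex.exp ((inner ℝ w₀.1 x : ℝ) : ℂ))) :=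
      ((Complex.continuous_exp.comp Complex.continuous_ofReal).tendsto _).comp (hre x hx)
    -- Dividing by the moduli and by the limit leaves `exp (i ⟨b_n - b, x⟩)`, where `b_n` and `b`
    -- are the imaginary parts.
    have h1 := ((h x hx).div hre' (Complex.exp_ne_zero _)).div_const
      (Complex.exp (pairing w₀ x) / Complex.exp ((inner ℝ w₀.1 x : ℝ) : ℂ))
    rw [div_self (div_ne_zero (Complex.exp_ne_zero _) (Complex.exp_ne_zero _))] at h1
    refine h1.congr fun n => ?_
    rw [Pi.div_apply, ← Complex.exp_sub, ← Complex.exp_sub, ← Complex.exp_sub]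
    simp only [pairing, inner_sub_left, Complex.ofReal_sub]
    ring_nf

variable [MeasurableSpace V] [BorelSpace V] {E : Set V} {P : TransitionFunction E}

lemma TransitionFunction.StochasticallyContinuous.continuousOn_expInt
    (hP : P.StochasticallyContinuous) (x : E) (k : ℕ) :
    ContinuousOn (fun q : ℝ≥0 × ℝ≥0 × Cplx V => P.expInt q.1 q.2.1 q.2.2 x)
      (timeExponents E k) := by
  rw [continuousOn_iff_continuous_domRestrict, continuous_iff_continuousAt]
  intro q₀
  let τ : timeExponents E k → TimePair := fun q => ⟨(q.1.1, q.1.2.1), q.2.1⟩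
  have hτ : Continuous τ := by fun_prop
  have hu : Continuous fun q : timeExponents E k => q.1.2.2 := by fun_prop
  exact ProbabilityMeasure.tendsto_integral_of_tendstoUniformlyOn
    (((hP (Sum.inl x)).comp hτ).tendsto q₀)
    (continuous_subtype_val.norm.sumElim continuous_const)
    (fun q => continuous_expFun E q.1.2.2) (continuous_expFun E q₀.1.2.2)
    (fun q => norm_expFun_le q.2.2) (norm_expFun_le q₀.2.2)
    fun m => tendstoUniformlyOn_expFun (hu.tendsto q₀) E m

lemma TransitionFunction.stochasticallyContinuous_of_continuousOn_expInt (hE : IsClosed E)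
    (h : ∀ x : E, ContinuousOn (fun q : ℝ≥0 × ℝ≥0 × Cplx V => P.expInt q.1 q.2.1 q.2.2 x)
      (timeExponents E 1)) : P.StochasticallyContinuous := by
  rintro (x | _)
  · refine continuous_iff_continuousAt.2 fun p => tendsto_of_seq_tendsto fun r hr =>
      tendsto_of_tendsto_integral_expFun hE fun v => ?_
    have h1 : Continuous fun p : TimePair => P.expInt p.1.1 p.1.2 (0, v) x :=
      (h x).comp_continuous (f := fun p : TimePair => (p.1.1, p.1.2, ((0, v) : Cplx V)))
        (by fun_prop) fun p => ⟨p.2, zero_prod_mem_boundedExponentsBy E v⟩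
    exact (h1.tendsto p).comp hr
  · have h1 : ∀ p q : TimePair, P.law (cemetery E) p = P.law (cemetery E) q := fun p q =>
      Subtype.ext ((P.absorbing _ _ p.2).trans (P.absorbing _ _ q.2).symm)
    exact continuous_of_const h1

end AffineProcess

theorem mainTheorem8 {V : Type*} [NormedAddCommGroup V] [InnerProductSpace ℝ V]
    [FiniteDimensional ℝ V] [MeasurableSpace V] [BorelSpace V]
    (E : Set V) (hE : IsClosed E) (h0 : (0 : V) ∈ E)
    (hcomp : ∃ x ∈ E, ∃ b : AffineBasis (Fin (Module.finrank ℝ V + 1)) ℝ V,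
      ∀ i, b i ∈ connectedComponentIn E x)
    (P : AffineProcess.TransitionFunction E)
    (Φ : ℝ≥0 → ℝ≥0 → AffineProcess.Cplx V → ℂ)
    (ψ : ℝ≥0 → ℝ≥0 → AffineProcess.Cplx V → AffineProcess.Cplx V)
    (haff : P.IsAffineWith Φ ψ) :
    P.StochasticallyContinuous ↔
      ((∀ k : ℕ, ContinuousOn (fun q : ℝ≥0 × ℝ≥0 × AffineProcess.Cplx V => ψ q.1 q.2.1 q.2.2)
          (AffineProcess.nonvanishingDomain E Φ k)) ∧
        ψ 0 0 0 = 0 ∧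
        (∀ k : ℕ, ContinuousOn (fun q : ℝ≥0 × ℝ≥0 × AffineProcess.Cplx V => Φ q.1 q.2.1 q.2.2)
          (AffineProcess.timeExponents E k)) ∧
        (∀ (x : E) (k : ℕ), ContinuousOn
          (fun q : ℝ≥0 × ℝ≥0 × AffineProcess.Cplx V => P.expInt q.1 q.2.1 q.2.2 x)
          (AffineProcess.timeExponents E k))) := by
  refine ⟨fun hP => ?_, fun h =>
    P.stochasticallyContinuous_of_continuousOn_expInt hE fun x => h.2.2.2 x 1⟩
  obtain ⟨x₀, hx₀E, b, hb⟩ := hcomp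
  have hx₀ := subset_closure (mem_connectedComponentIn hx₀E)
  have hspan := AffineProcess.span_sub_eq_top_of_affineBasis b (fun i => subset_closure (hb i)) hx₀
  have hCE : closure (connectedComponentIn E x₀) ⊆ E :=
    closure_minimal (connectedComponentIn_subset E x₀) hE
  have hψ := fun w w₀ => AffineProcess.tendsto_of_tendsto_exp_pairing (w := w) (w₀ := w₀)
    isClosed_closure isPreconnected_connectedComponentIn.closure hx₀ hspan
  have hexp := hP.continuousOn_expInt
  have hΦ : ∀ k : ℕ, ContinuousOn
      (fun q : ℝ≥0 × ℝ≥0 × AffineProcess.Cplx V => Φ q.1 q.2.1 q.2.2)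
      (AffineProcess.timeExponents E k) := fun k =>
    (hexp ⟨0, h0⟩ k).congr fun q hq =>
      haff.eq_expInt_zero h0 hq.1 (AffineProcess.mem_boundedExponents hq.2)
  refine ⟨fun k q₀ hq₀ => ?_, ?_, hΦ, hexp⟩
  · refine tendsto_of_seq_tendsto fun r hr => hψ _ _ fun x hx => ?_
    have hdom : AffineProcess.nonvanishingDomain E Φ k ⊆ AffineProcess.timeExponents E k :=
      fun q hq => hq.1
    have hne : ∀ q ∈ AffineProcess.nonvanishingDomain E Φ k, Φ q.1 q.2.1 q.2.2 ≠ 0 :=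
      fun q hq => hq.2 q.1 le_rfl hq.1.1
    have h1 : ContinuousOn
        (fun q : ℝ≥0 × ℝ≥0 × AffineProcess.Cplx V =>
          Complex.exp (AffineProcess.pairing (ψ q.1 q.2.1 q.2.2) x))
        (AffineProcess.nonvanishingDomain E Φ k) :=
      -- `exp ⟨ψ, x⟩` is the quotient of `P f_u(x)` by `Φ`, nonzero by the case `v = t` of the
      -- condition.
      (((hexp ⟨x, hCE hx⟩ k).mono hdom).div ((hΦ k).mono hdom) hne).congr fun q hq => by
        rw [Pi.div_apply, haff _ _ hq.1.1 _ (AffineProcess.mem_boundedExponents hq.1.2),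
          mul_div_cancel_left₀ _ (hne q hq)]
    exact (h1 q₀ hq₀).tendsto.comp hr
  · have hu : (0 : AffineProcess.Cplx V) ∈ AffineProcess.boundedExponents E :=
      AffineProcess.mem_boundedExponents (AffineProcess.zero_prod_mem_boundedExponentsBy E 0)
    -- `exp ⟨ψ 0 0 0, x⟩ = 1` on the component, so the constant sequence `ψ 0 0 0` also tends to
    -- `0`.
    refine tendsto_nhds_unique (tendsto_const_nhds (f := atTop (α := ℕ)))
      (hψ (fun _ => ψ 0 0 0) 0 fun x hx => ?_)
    have h1 := haff 0 0 le_rfl 0 hu ⟨x, hCE hx⟩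
    rw [haff.eq_expInt_zero h0 le_rfl hu, P.expInt_self, P.expInt_self,
      AffineProcess.pairing_zero_right, Complex.exp_zero, one_mul] at h1
    exact h1 ▸ tendsto_const_nhds
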